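/- **Models.** Alphabets are finite and nonempty; an input $x$ of length $n$ over $\Sigma$ is written on a tape as $\cent x\$$ (cells $0,\dots,n+1$), and $\check\Sigma=\Sigma\cup\{\cent,\$\}$. A *1qfa* (measure-many one-way quantum finite automaton) has a finite set $Q=Q_{non}\sqcup Q_{acc}\sqcup Q_{rej}$ of inner states, an initial state $q_0\in Q_{non}$, and a unitary operator $V_\sigma$ on $\mathbb C^{Q}$ for each $\sigma\in\check\Sigma$. Starting in $|q_0\rangle$, it reads $\cent x\$$ from left to right in $n+2$ steps; each step applies $V_\sigma$ for the scanned symbol $\sigma$ and then measures whether the state is accepting, rejecting or non-halting, and only the non-halting part continues. $\mathrm{1QFA}$ is the class of languages $L$ for which some 1qfa and some $\epsilon>0$ satisfy: every $x\in L$ is accepted, and every $x\notin L$ is rejected, with probability at least $1/2+\epsilon$. $\mathrm{1RFA}$ is the class of languages recognized in this sense by *one-way reversible finite automata*, i.e. 1qfa's all of whose transition amplitudes are $0$ or $1$. A *1qfa verifier* $V$ is defined in the same way, except that it also has a communication cell with a finite alphabet $\Gamma$ containing a blank symbol $\#$, and each $V_\sigma$ is a unitary operator on $\mathbb C^{Q\times\Gamma}$.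 A *prover* $P$ has a semi-infinite private tape over a finite alphabet $\Delta$ with a blank; for each input $x$ and each $i\ge 1$ it has a unitary operator $S\otimes I$, where $S$ acts on the communication cell together with some finite initial segment of the private tape. The computation of $(P,V)$ on $x$ starts in $|q_0\rangle|\#\rangle|\text{all-blank tape}\rangle$; verifier and prover move in turn, the verifier first, and each verifier move is followed by the accept/reject/non-halting measurement; the verifier stops after the measurement that follows its step scanning $\$$. $(P,V)$ is an $(a,b)$-*QIP system* for $L$ if every $x\in L$ is accepted by $(P,V)$ with probability at least $a$, and for every $x\notin L$ and every prover $P^*$, $(P^*,V)$ rejects $x$ with probability at least $b$. The verifier is *public* if every inner state $q'$ has a communication symbol $\xi_{q'}\in\Gamma$ announcing it, the symbols $\xi_{q'}$ for $q'\in Q_{non}$ being pairwise distinct and different from $\#$, such that for all $\sigma\in\check\Sigma$, $q\in Q_{non}$ and $\gamma\in\Gamma$ the vector $V_\sigma|q\rangle|\gamma\rangle$ is a linear combination of the vectors $|q'\rangle|\xi_{q'}\rangle$, $q'\in Q$. $\mathrm{QIP}_{1,1}(1qfa,public)$ is the class of languages having a $(1,1)$-QIP system whose verifier is a public 1qfa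 verifier. **Theorem.** $\mathrm{1RFA}\subsetneq \mathrm{QIP}_{1,1}(1qfa,public)$ and $\mathrm{QIP}_{1,1}(1qfa,public)\nsubseteq \mathrm{1QFA}$. Moreover, the language $Zero=\{w0 : w\in\{0,1\}^*\}$ belongs to $\mathrm{QIP}_{1,1}(1qfa,public)$ but not to $\mathrm{1QFA}$. -/

import Mathlib

open scoped BigOperators

noncomputable section

namespace QFA

/-! ### Input tape and halting status -/

/-- Symbols on the input tape: the left endmarker, an input letter, the right endmarker. -/
inductive TapeSymbol (α : Type) : Type
  | leftEnd : TapeSymbol α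
  | letter : α → TapeSymbol α
  | rightEnd : TapeSymbol α

/-- The content of cell `t` of the tape holding `x`: cell `0` holds the left endmarker, cell `i`
with `1 ≤ i ≤ |x|` the `i`-th letter of `x`, and cell `|x| + 1` the right endmarker. -/
def tapeCell {α : Type} (x : List α) : ℕ → TapeSymbol α
  | 0 => TapeSymbol.leftEnd
  | i + 1 =>
    match x[i]? with
    | some a => TapeSymbol.letter a
    | none => TapeSymbol.rightEnd

/-- An inner state is exactly one of: non-halting, accepting, rejecting. -/
inductive Status : Type
  | non : Status
  | acc : Status
  | rej : Status
  deriving DecidableEq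

/-! ### Languages and classes of languages -/

/-- A language together with its (finite, nonempty) alphabet. -/
structure FormalLanguage where
  alphabet : Type
  finite_alphabet : Finite alphabet
  nonempty_alphabet : Nonempty alphabet
  words : Language alphabet

/-- `Zero = {w0 | w ∈ {0,1}*}`. -/
def zeroLanguage : FormalLanguage where
  alphabet := Fin 2
  finite_alphabet := inferInstance
  nonempty_alphabet := inferInstance
  words := {x | ∃ w : List (Fin 2), x = w ++ [0]}

/-! ### Measure-many one-way quantum finite automata -/

/-- A measure-many one-way quantum finite automaton. The entry `V σ q' q` is the amplitude of
moving from `q` to `q'` when scanning `σ`; the head then moves one cell to the right. -/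
structure OneWayQFA (α : Type) where
  Q : Type
  [fintypeQ : Fintype Q]
  [decEqQ : DecidableEq Q]
  status : Q → Status
  start : Q
  start_non : status start = Status.non
  V : TapeSymbol α → Matrix.unitaryGroup Q ℂ

attribute [instance] OneWayQFA.fintypeQ OneWayQFA.decEqQ

namespace OneWayQFA

variable {α : Type} (M : OneWayQFA α)

/-- Unmeasured result of applying the transition for `σ` to `ψ`. -/
def move (σ : TapeSymbol α) (ψ : M.Q → ℂ) : M.Q → ℂ :=
  Matrix.mulVec (M.V σ : Matrix M.Q M.Q ℂ) ψ

/-- The (unnormalized) non-halting superposition after `t` steps on input `x`. -/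
def state (x : List α) : ℕ → (M.Q → ℂ)
  | 0 => Pi.single M.start 1
  | t + 1 => fun q => if M.status q = Status.non then M.move (tapeCell x t) (state x t) q else 0

/-- The probability that the measurements performed during the `|x| + 2` steps on input `x`
(the last one being the step that scans the right endmarker) ever produce the outcome `s`. -/
def haltProb (s : Status) (x : List α) : ℝ :=
  ∑ t ∈ Finset.range (x.length + 2),
    ∑ q : M.Q, if M.status q = s then ‖M.move (tapeCell x t) (M.state x t) q‖ ^ 2 else 0

/-- Recognition with bounded error. -/
def Recognizes (L : Language α) : Prop :=
  ∃ ε : ℝ, 0 < ε ∧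
    (∀ x, x ∈ L → 1 / 2 + ε ≤ M.haltProb Status.acc x) ∧
    (∀ x, x ∉ L → 1 / 2 + ε ≤ M.haltProb Status.rej x)

/-- A one-way (deterministic) reversible finite automaton: all amplitudes are `0` or `1`.
(The acceptance and rejection probabilities are then `0` or `1` too.) -/
def IsReversible : Prop :=
  ∀ (σ : TapeSymbol α) (q' q : M.Q),
    (M.V σ : Matrix M.Q M.Q ℂ) q' q = 0 ∨ (M.V σ : Matrix M.Q M.Q ℂ) q' q = 1

end OneWayQFA

/-- The class 1QFA. -/
def OneQFA : Set FormalLanguage :=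
  {L | ∃ M : OneWayQFA L.alphabet, M.Recognizes L.words}

/-- The class 1RFA. -/
def OneRFA : Set FormalLanguage :=
  {L | ∃ M : OneWayQFA L.alphabet, M.IsReversible ∧ M.Recognizes L.words}

/-! ### Quantum interactive proof systems with 1qfa verifiers -/

/-- A 1qfa verifier. The entry `V σ (q', γ') (q, γ)` is the amplitude with which the verifier, in
state `q` and scanning `σ` on the input tape and `γ` in the communication cell, changes `q` to `q'`,
writes `γ'` into the communication cell, and moves its head one cell to the right.
Since the head always moves right on the circular tape, the global one-step operator on
`(state, head position, communication symbol)` is unitary for every input if and only if each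
`V σ` is. -/
structure Verifier (α : Type) where
  Q : Type
  [fintypeQ : Fintype Q]
  [decEqQ : DecidableEq Q]
  Γ : Type
  [fintypeΓ : Fintype Γ]
  [decEqΓ : DecidableEq Γ]
  status : Q → Status
  start : Q
  start_non : status start = Status.non
  blank : Γ
  V : TapeSymbol α → Matrix.unitaryGroup (Q × Γ) ℂ

attribute [instance] Verifier.fintypeQ Verifier.decEqQ Verifier.fintypeΓ Verifier.decEqΓ

/-- The publicness condition. Each inner state `q'` has a communication symbol `name q'` announcing
it; the announcements of non-halting states are pairwise distinct and different from the blank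
symbol. In a non-halting state, whatever it scans and receives, the verifier writes `name q'` into
the communication cell whenever it moves to `q'`. -/
def Verifier.IsPublic {α : Type} (W : Verifier α) : Prop :=
  ∃ name : W.Q → W.Γ,
    Set.InjOn name {q | W.status q = Status.non} ∧
    (∀ q, W.status q = Status.non → name q ≠ W.blank) ∧
    ∀ (σ : TapeSymbol α) (q : W.Q) (γ : W.Γ), W.status q = Status.non →
      ∀ (q' : W.Q) (ξ : W.Γ),
        (W.V σ : Matrix (W.Q × W.Γ) (W.Q × W.Γ) ℂ) (q', ξ) (q, γ) ≠ 0 → ξ = name q'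

/-- Contents of a semi-infinite tape over `Δ` with finitely many non-blank cells. -/
def PrivateTape (Δ : Type) (blank : Δ) : Type :=
  {y : ℕ → Δ // {i | y i ≠ blank}.Finite}

namespace PrivateTape

variable {Δ : Type} {blank : Δ}

/-- The all-blank tape. -/
def empty (Δ : Type) (blank : Δ) : PrivateTape Δ blank :=
  ⟨fun _ => blank, by simp⟩

/-- The content of the first `m` cells. -/
def window (m : ℕ) (y : PrivateTape Δ blank) : Fin m → Δ := fun i => y.1 i

/-- Replace the content of the first `m` cells by `w`. -/
def overwrite {m : ℕ} (w : Fin m → Δ) (y : PrivateTape Δ blank) : PrivateTape Δ blank :=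
  ⟨fun i => if h : i < m then w ⟨i, h⟩ else y.1 i, by
    refine ((Set.finite_Iio m).union y.2).subset fun i hi => ?_
    by_cases h : i < m
    · exact Or.inl h
    · right
      simpa [h] using hi⟩

end PrivateTape

/-- A prover (for communication alphabet `Γ` and inputs over `α`). At its `(i+1)`-st turn on input
`x` it applies the unitary operator `S ⊗ I`, where `S = strategy x i` acts on the communication
cell together with the first `width x i` cells of the private tape. -/
structure Prover (α Γ : Type) [Fintype Γ] [DecidableEq Γ] where
  Δ : Type
  [fintypeΔ : Fintype Δ]
  [decEqΔ : DecidableEq Δ]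
  blank : Δ
  width : List α → ℕ → ℕ
  strategy : (x : List α) → (i : ℕ) → Matrix.unitaryGroup (Γ × (Fin (width x i) → Δ)) ℂ

attribute [instance] Prover.fintypeΔ Prover.decEqΔ

section Protocol

variable {α : Type} (W : Verifier α) (P : Prover α W.Γ)

/-- A global configuration: inner state, communication symbol, content of the prover's tape. The
position of the verifier's head is not recorded, since just before step `t + 1` it is `t`. -/
abbrev Config : Type := W.Q × W.Γ × PrivateTape P.Δ P.blank

/-- A (finite) superposition of global configurations. All superpositions that occur in a
computation are finite, since every operator involved maps a configuration to a finite
superposition. -/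
abbrev Superposition : Type := Config W P →₀ ℂ

/-- The verifier's operator for the scanned symbol `σ`, tensored with the identity on the prover's
private tape. -/
def verifierOp (σ : TapeSymbol α) : Superposition W P →ₗ[ℂ] Superposition W P :=
  Finsupp.linearCombination ℂ fun c : Config W P =>
    ∑ r : W.Q × W.Γ,
      Finsupp.single ((r.1, r.2, c.2.2) : Config W P)
        ((W.V σ : Matrix (W.Q × W.Γ) (W.Q × W.Γ) ℂ) r (c.1, c.2.1))

/-- The prover's operator at its `(i+1)`-st turn on input `x`, tensored with the identity on the
verifier's inner states. -/
def proverOp (x : List α) (i : ℕ) : Superposition W P →ₗ[ℂ] Superposition W P :=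
  Finsupp.linearCombination ℂ fun c : Config W P =>
    ∑ r : W.Γ × (Fin (P.width x i) → P.Δ),
      Finsupp.single ((c.1, r.1, c.2.2.overwrite r.2) : Config W P)
        ((P.strategy x i : Matrix (W.Γ × (Fin (P.width x i) → P.Δ))
            (W.Γ × (Fin (P.width x i) → P.Δ)) ℂ) r (c.2.1, c.2.2.window (P.width x i)))

/-- The projection onto the configurations whose inner state has status `s`. -/
def project (s : Status) (Φ : Superposition W P) : Superposition W P :=
  Φ.filter fun c => W.status c.1 = s

/-- The squared norm of a superposition. -/
def normSq (Φ : Superposition W P) : ℝ := Φ.sum fun _ a => ‖a‖ ^ 2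

/-- The superposition just before the verifier's step `t + 1` on input `x`: the verifier moves, the
non-halting part survives the measurement, and the prover moves. -/
def protocolState (x : List α) : ℕ → Superposition W P
  | 0 => Finsupp.single (W.start, W.blank, PrivateTape.empty P.Δ P.blank) 1
  | t + 1 =>
    proverOp W P x t
      (project W P Status.non (verifierOp W P (tapeCell x t) (protocolState x t)))

/-- The probability that the measurements performed during the verifier's `|x| + 2` steps on input
`x` (the last one being the step that scans the right endmarker) ever produce the outcome `s`. -/
def protocolProb (s : Status) (x : List α) : ℝ :=
  ∑ t ∈ Finset.range (x.length + 2),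
    normSq W P (project W P s (verifierOp W P (tapeCell x t) (protocolState W P x t)))

end Protocol

/-- `(P, W)` is an `(a,b)`-QIP system for `L`. -/
def IsQIPSystem {α : Type} (a b : ℝ) (W : Verifier α) (P : Prover α W.Γ) (L : Language α) : Prop :=
  (∀ x, x ∈ L → a ≤ protocolProb W P Status.acc x) ∧
  (∀ x, x ∉ L → ∀ P' : Prover α W.Γ, b ≤ protocolProb W P' Status.rej x)

/-- The class of languages having a public `(a,b)`-QIP system with a 1qfa verifier. -/
def PublicQIP (a b : ℝ) : Set FormalLanguage :=
  {L | ∃ (W : Verifier L.alphabet) (P : Prover L.alphabet W.Γ),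
    W.IsPublic ∧ IsQIPSystem a b W P L.words}

end QFA

end

/-! Every claim reduces to three facts: reversible automata can be simulated by public verifiers,
`Zero` has a public protocol, and no 1qfa recognizes `Zero`.

Both protocols are deterministic on the verifier's side (`DetProtocol`). A partial injection of a
finite set extends to a permutation, hence to a unitary, so only injectivity on continuing
transitions must be checked. Provers are arbitrary unitaries, but only the support of the
superposition is tracked: if an invariant of reachable configurations excludes one halting outcome
and excludes surviving past the endmarker, conservation of norm gives the other outcome probability
1 (`protocolProb_eq_one`).

For simulation, 0/1 unitaries are permutation matrices. The verifier runs the automaton and rejects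
unless its announcement comes back unchanged, so cheating can only cause rejection. For `Zero`, the
prover flags the last letter, and the verifier checks that this letter is 0 and that the endmarker
follows.

For the lower bound, the norm of the non-halting part never increases. After a word whose norm is
almost the infimum, further measurements remove almost nothing, so reading 1s acts nearly as powers
of a fixed unitary; by compactness some positive power is near the identity. Hence some `w0` and
`w01^j` lead to nearly the same state, and the second word is accepted almost as often as the first.
-/

noncomputable section

namespace QFA

/-! ### Unitaries acting on one component of a configuration: norms and supports. -/

section LocalOperator

variable {C K B : Type} [Fintype K]

/-- The operator acting as the matrix `U` on the component `k c` of a configuration `c`, where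
`put c r` is the configuration obtained from `c` by replacing that component by `r`. -/
def localOp (put : C → K → C) (k : C → K) (U : Matrix K K ℂ) : (C →₀ ℂ) →ₗ[ℂ] (C →₀ ℂ) :=
  Finsupp.linearCombination ℂ fun c => ∑ r, Finsupp.single (put c r) (U r (k c))

/-- The standard inner product on finitely supported functions. -/
def finsuppInner (Φ Ψ : C →₀ ℂ) : ℂ := Φ.sum fun c a => star a * Ψ c

theorem finsuppInner_add_left (Φ Φ' Ψ : C →₀ ℂ) :
    finsuppInner (Φ + Φ') Ψ = finsuppInner Φ Ψ + finsuppInner Φ' Ψ := by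
  classical
  exact Finsupp.sum_add_index' (by simp) (by intros; simp [add_mul])

theorem finsuppInner_add_right (Φ Ψ Ψ' : C →₀ ℂ) :
    finsuppInner Φ (Ψ + Ψ') = finsuppInner Φ Ψ + finsuppInner Φ Ψ' := by
  simp [finsuppInner, Finsupp.sum, mul_add, Finset.sum_add_distrib]

theorem finsuppInner_zero_left (Ψ : C →₀ ℂ) : finsuppInner 0 Ψ = 0 := by
  simp [finsuppInner]

theorem finsuppInner_zero_right (Φ : C →₀ ℂ) : finsuppInner Φ 0 = 0 := by
  simp [finsuppInner]

theorem finsuppInner_smul_left (a : ℂ) (Φ Ψ : C →₀ ℂ) :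
    finsuppInner (a • Φ) Ψ = star a * finsuppInner Φ Ψ := by
  rw [finsuppInner, Finsupp.sum_smul_index' (by simp), finsuppInner, Finsupp.mul_sum]
  simp [mul_assoc]

theorem finsuppInner_smul_right (a : ℂ) (Φ Ψ : C →₀ ℂ) :
    finsuppInner Φ (a • Ψ) = a * finsuppInner Φ Ψ := by
  simp [finsuppInner, Finsupp.mul_sum, mul_left_comm]

theorem finsuppInner_single_single [DecidableEq C] (c c' : C) (a a' : ℂ) :
    finsuppInner (Finsupp.single c a) (Finsupp.single c' a') =
      if c = c' then star a * a' else 0 := by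
  rw [finsuppInner, Finsupp.sum_single_index (by simp), Finsupp.single_apply]
  by_cases h : c' = c
  · simp [h]
  · simp [h, Ne.symm h]

theorem finsuppInner_sum_left {ι : Type} (s : Finset ι) (Φ : ι → C →₀ ℂ) (Ψ : C →₀ ℂ) :
    finsuppInner (∑ i ∈ s, Φ i) Ψ = ∑ i ∈ s, finsuppInner (Φ i) Ψ := by
  classical
  induction s using Finset.induction_on with
  | empty => simp [finsuppInner_zero_left]
  | insert i s hi ih => rw [Finset.sum_insert hi, Finset.sum_insert hi, finsuppInner_add_left, ih]

theorem finsuppInner_sum_right {ι : Type} (s : Finset ι) (Φ : C →₀ ℂ) (Ψ : ι → C →₀ ℂ) :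
    finsuppInner Φ (∑ i ∈ s, Ψ i) = ∑ i ∈ s, finsuppInner Φ (Ψ i) := by
  classical
  induction s using Finset.induction_on with
  | empty => simp [finsuppInner_zero_right]
  | insert i s hi ih => rw [Finset.sum_insert hi, Finset.sum_insert hi, finsuppInner_add_right, ih]

theorem finsuppInner_self (Φ : C →₀ ℂ) :
    finsuppInner Φ Φ = ((Φ.sum fun _ a => ‖a‖ ^ 2 : ℝ) : ℂ) := by
  simp only [finsuppInner, Finsupp.sum, Complex.ofReal_sum]
  refine Finset.sum_congr rfl fun c _ => ?_
  rw [Complex.star_def, ← Complex.normSq_eq_conj_mul_self, Complex.normSq_eq_norm_sq]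

theorem localOp_single (put : C → K → C) (k : C → K) (U : Matrix K K ℂ) (c : C) (a : ℂ) :
    localOp put k U (Finsupp.single c a) =
      a • ∑ r, Finsupp.single (put c r) (U r (k c)) := by
  simp [localOp]

variable {put : C → K → C} {k : C → K} {b : C → B}

/-- The pair (`b`, `k`) acts as coordinates, `b` being the untouched part, so the operator is `U` on
each fibre of `b`. By sesquilinearity it suffices to treat basis vectors, where the columns of `U`
are orthonormal. -/
theorem finsuppInner_localOp [DecidableEq K] (hinj : ∀ c c', b c = b c' → k c = k c' → c = c')
    (hb : ∀ c r, b (put c r) = b c) (hk : ∀ c r, k (put c r) = r)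
    (U : Matrix.unitaryGroup K ℂ) (Φ Ψ : C →₀ ℂ) :
    finsuppInner (localOp put k U Φ) (localOp put k U Ψ) = finsuppInner Φ Ψ := by
  classical
  induction Φ using Finsupp.induction_linear with
  | zero => simp [finsuppInner_zero_left]
  | add f g hf hg => simp [finsuppInner_add_left, hf, hg]
  | single c a =>
    induction Ψ using Finsupp.induction_linear with
    | zero => simp [finsuppInner_zero_right]
    | add f g hf hg => simp [finsuppInner_add_right, hf, hg]
    | single c' a' =>
      rw [localOp_single, localOp_single, finsuppInner_smul_left, finsuppInner_smul_right,
        finsuppInner_sum_left]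
      simp only [finsuppInner_sum_right, finsuppInner_single_single]
      have key : ∀ r r', (put c r = put c' r') ↔ (b c = b c' ∧ r = r') := by
        intro r r'
        constructor
        · intro h
          exact ⟨by rw [← hb c r, h, hb], by rw [← hk c r, h, hk]⟩
        · rintro ⟨h, rfl⟩
          exact hinj _ _ (by rw [hb, hb, h]) (by rw [hk, hk])
      simp only [key]
      by_cases h : b c = b c'
      · have hU : ∑ r, star ((U : Matrix K K ℂ) r (k c)) * (U : Matrix K K ℂ) r (k c') =
            if k c = k c' then 1 else 0 := by
          have := congrFun (congrFun (Matrix.UnitaryGroup.star_mul_self U) (k c)) (k c')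
          rw [Matrix.one_apply, Matrix.mul_apply] at this
          rw [← this]
          rfl
        have hcc : (k c = k c') ↔ (c = c') := ⟨hinj _ _ h, fun h => h ▸ rfl⟩
        simp only [h, true_and, Finset.sum_ite_eq, Finset.mem_univ, if_true, hU, hcc]
        split_ifs <;> simp
      · have hcc : c ≠ c' := fun h' => h (h' ▸ rfl)
        simp [h, hcc]

theorem sum_norm_sq_localOp [DecidableEq K] (hinj : ∀ c c', b c = b c' → k c = k c' → c = c')
    (hb : ∀ c r, b (put c r) = b c) (hk : ∀ c r, k (put c r) = r)
    (U : Matrix.unitaryGroup K ℂ) (Φ : C →₀ ℂ) :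
    ((localOp put k U Φ).sum fun _ a => ‖a‖ ^ 2) = Φ.sum fun _ a => ‖a‖ ^ 2 := by
  have h := finsuppInner_localOp hinj hb hk U Φ Φ
  rw [finsuppInner_self, finsuppInner_self] at h
  exact_mod_cast h

/-- A nonzero sum has a nonzero term. Interference can only shrink the support, so reachability
bounds it from above. -/
theorem exists_of_localOp_ne_zero (U : Matrix K K ℂ) (Φ : C →₀ ℂ) (c' : C)
    (h : localOp put k U Φ c' ≠ 0) :
    ∃ c, Φ c ≠ 0 ∧ ∃ r, put c r = c' ∧ U r (k c) ≠ 0 := by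
  classical
  rw [localOp, Finsupp.linearCombination_apply, Finsupp.sum, Finsupp.finsetSum_apply] at h
  obtain ⟨c, hc, hne⟩ := Finset.exists_ne_zero_of_sum_ne_zero h
  rw [Finsupp.smul_apply, Finsupp.finsetSum_apply] at hne
  obtain ⟨r, -, hr⟩ := Finset.exists_ne_zero_of_sum_ne_zero (right_ne_zero_of_smul hne)
  rw [Finsupp.single_apply] at hr
  refine ⟨c, Finsupp.mem_support_iff.1 hc, r, ?_⟩
  split_ifs at hr with hput
  · exact ⟨hput, hr⟩
  · exact absurd rfl hr

end LocalOperator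

/-! ### Conservation of probability and support invariants of the protocol. -/

section Conservation

variable {α : Type} (W : Verifier α) (P : Prover α W.Γ)

theorem verifierOp_eq_localOp (σ : TapeSymbol α) :
    verifierOp W P σ = localOp (fun (c : Config W P) (r : W.Q × W.Γ) => (r.1, r.2, c.2.2))
      (fun c => (c.1, c.2.1)) (W.V σ) := rfl

theorem proverOp_eq_localOp (x : List α) (i : ℕ) :
    proverOp W P x i = localOp
      (fun (c : Config W P) (r : W.Γ × (Fin (P.width x i) → P.Δ)) =>
        (c.1, r.1, c.2.2.overwrite r.2))
      (fun c => (c.2.1, c.2.2.window (P.width x i))) (P.strategy x i) := rfl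

theorem normSq_verifierOp (σ : TapeSymbol α) (Φ : Superposition W P) :
    normSq W P (verifierOp W P σ Φ) = normSq W P Φ := by
  rw [verifierOp_eq_localOp]
  refine sum_norm_sq_localOp (b := fun c : Config W P => c.2.2) ?_ ?_ ?_ _ _
  · rintro ⟨q, γ, y⟩ ⟨q', γ', y'⟩ h h'
    simp_all
  · intros; rfl
  · intros; rfl

theorem normSq_proverOp (x : List α) (i : ℕ) (Φ : Superposition W P) :
    normSq W P (proverOp W P x i Φ) = normSq W P Φ := by
  rw [proverOp_eq_localOp]
  -- The untouched part is the inner state with the tape outside the window; the window is masked by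
  -- blanks.
  refine sum_norm_sq_localOp (b := fun c : Config W P =>
    (c.1, fun j : ℕ => if j < P.width x i then P.blank else c.2.2.1 j)) ?_ ?_ ?_ _ _
  · rintro ⟨q, γ, y⟩ ⟨q', γ', y'⟩ h h'
    simp only [Prod.mk.injEq] at h h'
    obtain ⟨rfl, h⟩ := h
    obtain ⟨rfl, h'⟩ := h'
    have hy : y = y' := by
      refine Subtype.ext (funext fun j => ?_)
      by_cases hj : j < P.width x i
      · exact congrFun h' ⟨j, hj⟩
      · simpa [hj] using congrFun h j
    rw [hy]
  · intro c r
    refine Prod.ext rfl (funext fun j => ?_)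
    by_cases hj : j < P.width x i <;> simp [hj, PrivateTape.overwrite]
  · intro c r
    refine Prod.ext rfl (funext fun j => ?_)
    simp [PrivateTape.window, PrivateTape.overwrite]

theorem normSq_eq_sum_project (Φ : Superposition W P) :
    normSq W P Φ = normSq W P (project W P Status.non Φ) +
      (normSq W P (project W P Status.acc Φ) + normSq W P (project W P Status.rej Φ)) := by
  have key : ∀ s, normSq W P (project W P s Φ) =
      ∑ c ∈ Φ.support, if W.status c.1 = s then ‖Φ c‖ ^ 2 else 0 := by
    intro s
    rw [normSq, project, Finsupp.sum, Finsupp.support_filter, Finset.sum_filter]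
    refine Finset.sum_congr rfl fun c _ => ?_
    split_ifs with h <;> simp [h]
  rw [key, key, key, ← Finset.sum_add_distrib, ← Finset.sum_add_distrib, normSq, Finsupp.sum]
  refine Finset.sum_congr rfl fun c _ => ?_
  cases W.status c.1 <;> simp

theorem sum_halt_add_normSq (x : List α) (n : ℕ) :
    (∑ t ∈ Finset.range n,
      normSq W P (project W P Status.acc
        (verifierOp W P (tapeCell x t) (protocolState W P x t)))) +
    (∑ t ∈ Finset.range n,
      normSq W P (project W P Status.rej
        (verifierOp W P (tapeCell x t) (protocolState W P x t)))) +
      normSq W P (protocolState W P x n) = 1 := by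
  induction n with
  | zero => simp [protocolState, normSq]
  | succ n ih =>
    rw [Finset.sum_range_succ, Finset.sum_range_succ, protocolState, normSq_proverOp]
    rw [← normSq_verifierOp W P (tapeCell x n), normSq_eq_sum_project] at ih
    linarith

theorem protocolProb_acc_add_rej (x : List α) :
    protocolProb W P Status.acc x + protocolProb W P Status.rej x +
      normSq W P (protocolState W P x (x.length + 2)) = 1 :=
  sum_halt_add_normSq W P x _

variable {W P}

/-- The invariant does not mention the private tape, so it can be used against provers with
arbitrary memory and entanglement. -/
theorem protocolState_support {x : List α} (I : ℕ → W.Q → W.Γ → Prop)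
    (h0 : I 0 W.start W.blank)
    (hstep : ∀ t q γ q' ξ ξ' w w', I t q γ →
      (W.V (tapeCell x t) : Matrix (W.Q × W.Γ) (W.Q × W.Γ) ℂ) (q', ξ) (q, γ) ≠ 0 →
      W.status q' = Status.non →
      (P.strategy x t : Matrix (W.Γ × (Fin (P.width x t) → P.Δ))
        (W.Γ × (Fin (P.width x t) → P.Δ)) ℂ) (ξ', w) (ξ, w') ≠ 0 → I (t + 1) q' ξ')
    (t : ℕ) (c : Config W P) (hc : protocolState W P x t c ≠ 0) : I t c.1 c.2.1 := by
  induction t generalizing c with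
  | zero =>
    rw [protocolState, Finsupp.single_apply_ne_zero] at hc
    rw [hc.1]
    exact h0
  | succ t ih =>
    rw [protocolState, proverOp_eq_localOp] at hc
    obtain ⟨d, hd, r, rfl, hr⟩ := exists_of_localOp_ne_zero _ _ _ hc
    rw [project, Finsupp.filter_apply] at hd
    split_ifs at hd with hs
    · rw [verifierOp_eq_localOp] at hd
      obtain ⟨e, he, r', rfl, hr'⟩ := exists_of_localOp_ne_zero _ _ _ hd
      exact hstep t e.1 e.2.1 r'.1 r'.2 r.1 r.2 _ (ih e he) hr' hs hr
    · exact absurd rfl hd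

theorem project_verifierOp_eq_zero {s : Status} {σ : TapeSymbol α} {Φ : Superposition W P}
    (h : ∀ c, Φ c ≠ 0 → ∀ q' ξ,
      (W.V σ : Matrix (W.Q × W.Γ) (W.Q × W.Γ) ℂ) (q', ξ) (c.1, c.2.1) ≠ 0 → W.status q' ≠ s) :
    project W P s (verifierOp W P σ Φ) = 0 := by
  ext d
  rw [project, Finsupp.filter_apply]
  split_ifs with hs
  · by_contra hd
    rw [verifierOp_eq_localOp] at hd
    obtain ⟨e, he, r', rfl, hr'⟩ := exists_of_localOp_ne_zero _ _ _ hd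
    exact h e he r'.1 r'.2 hr' hs
  · rfl

theorem protocolProb_eq_zero {x : List α} {s : Status} (I : ℕ → W.Q → W.Γ → Prop)
    (hI : ∀ t c, protocolState W P x t c ≠ 0 → I t c.1 c.2.1)
    (hs : ∀ t, t < x.length + 2 → ∀ q γ q' ξ, I t q γ →
      (W.V (tapeCell x t) : Matrix (W.Q × W.Γ) (W.Q × W.Γ) ℂ) (q', ξ) (q, γ) ≠ 0 →
      W.status q' ≠ s) :
    protocolProb W P s x = 0 := by
  refine Finset.sum_eq_zero fun t ht => ?_
  rw [project_verifierOp_eq_zero, normSq, Finsupp.sum_zero_index]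
  intro c hc q' ξ
  exact hs t (Finset.mem_range.1 ht) _ _ _ _ (hI t c hc)

/-- If an invariant holds along the computation, excludes the halting status `bad`, and excludes
all configurations once the right endmarker has been scanned, then the other halting status
`good` occurs with certainty. -/
theorem protocolProb_eq_one {x : List α} {good bad : Status} (I : ℕ → W.Q → W.Γ → Prop)
    (hgb : (good = Status.acc ∧ bad = Status.rej) ∨ (good = Status.rej ∧ bad = Status.acc))
    (h0 : I 0 W.start W.blank)
    (hstep : ∀ t q γ q' ξ ξ' w w', I t q γ →
      (W.V (tapeCell x t) : Matrix (W.Q × W.Γ) (W.Q × W.Γ) ℂ) (q', ξ) (q, γ) ≠ 0 →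
      W.status q' = Status.non →
      (P.strategy x t : Matrix (W.Γ × (Fin (P.width x t) → P.Δ))
        (W.Γ × (Fin (P.width x t) → P.Δ)) ℂ) (ξ', w) (ξ, w') ≠ 0 → I (t + 1) q' ξ')
    (hbad : ∀ t, t < x.length + 2 → ∀ q γ q' ξ, I t q γ →
      (W.V (tapeCell x t) : Matrix (W.Q × W.Γ) (W.Q × W.Γ) ℂ) (q', ξ) (q, γ) ≠ 0 →
      W.status q' ≠ bad)
    (hend : ∀ q γ, ¬ I (x.length + 2) q γ) :
    protocolProb W P good x = 1 := by
  have hI := protocolState_support (P := P) I h0 hstep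
  have h1 := protocolProb_acc_add_rej W P x
  have h2 : protocolState W P x (x.length + 2) = 0 := by
    ext c
    by_contra hc
    exact hend _ _ (hI _ c hc)
  have h3 := protocolProb_eq_zero I hI hbad
  rw [h2, normSq, Finsupp.sum_zero_index, add_zero] at h1
  rcases hgb with ⟨rfl, rfl⟩ | ⟨rfl, rfl⟩ <;> linarith

end Conservation

/-- The permutation matrix of `e`, as a unitary matrix. -/
def permUnitary {K : Type} [Fintype K] [DecidableEq K] (e : Equiv.Perm K) :
    Matrix.unitaryGroup K ℂ :=
  ⟨Matrix.of fun r c => if e c = r then 1 else 0, by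
    rw [Matrix.mem_unitaryGroup_iff']
    ext i j
    simp [Matrix.mul_apply, Matrix.star_apply, Matrix.one_apply, eq_comm]⟩

theorem permUnitary_ne_zero_iff {K : Type} [Fintype K] [DecidableEq K] (e : Equiv.Perm K)
    (r c : K) : (permUnitary e : Matrix K K ℂ) r c ≠ 0 ↔ e c = r := by
  simp [permUnitary]

/-! ### Deterministic public verifiers -/

/-- A deterministic reversible protocol: in non-halting state `n`, having received a communication
symbol (either blank or the name of a non-halting state), the verifier moves to another
non-halting state or accepts (`true`) or rejects (`false`). -/
structure DetProtocol (α : Type) where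
  N : Type
  [fintypeN : Fintype N]
  [decEqN : DecidableEq N]
  start : N
  δ : TapeSymbol α → N × Option N → N ⊕ Bool
  δ_inj : ∀ σ a b n, δ σ a = Sum.inl n → δ σ b = Sum.inl n → a = b

attribute [instance] DetProtocol.fintypeN DetProtocol.decEqN

namespace DetProtocol

variable {α : Type} (D : DetProtocol α)

/-- The inner states of the verifier: the non-halting ones, and one halting state for every
outcome and every way of reaching it. -/
abbrev State : Type := D.N ⊕ (Bool × D.N × Option D.N)

/-- The communication symbol announcing an inner state. -/
def name : D.State → Option D.N
  | Sum.inl n => some n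
  | Sum.inr _ => none

/-- The inner state reached from `a`. -/
def next (σ : TapeSymbol α) (a : D.N × Option D.N) : D.State :=
  match D.δ σ a with
  | Sum.inl n => Sum.inl n
  | Sum.inr b => Sum.inr (b, a)

/-- Halting states store the pair they come from, so `δ_inj` is needed only for continuing
transitions. -/
theorem next_injective (σ : TapeSymbol α) : Function.Injective (D.next σ) := by
  intro a b h
  unfold next at h
  split at h <;> rename_i ha <;> split at h <;> rename_i hb
  · cases h
    exact D.δ_inj σ a b _ ha hb
  · cases h
  · cases h
  · cases h
    rfl

/-- An injection from part of a finite set extends to a permutation. Its values at halting states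
are arbitrary, since these never survive the measurement. -/
theorem exists_perm (σ : TapeSymbol α) : ∃ e : Equiv.Perm (D.State × Option D.N),
    ∀ a : D.N × Option D.N, e (Sum.inl a.1, a.2) = (D.next σ a, D.name (D.next σ a)) := by
  refine Equiv.Perm.exists_extending_pair
    (fun a : D.N × Option D.N => ((Sum.inl a.1, a.2) : D.State × Option D.N))
    (fun a => (D.next σ a, D.name (D.next σ a))) (fun a b h => ?_)
    (fun a b h => D.next_injective σ (congrArg Prod.fst h))
  simp only [Prod.mk.injEq, Sum.inl.injEq] at h
  exact Prod.ext h.1 h.2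

/-- The verifier's transition permutation. -/
def perm (σ : TapeSymbol α) : Equiv.Perm (D.State × Option D.N) := (D.exists_perm σ).choose

theorem perm_apply (σ : TapeSymbol α) (n : D.N) (γ : Option D.N) :
    D.perm σ (Sum.inl n, γ) = (D.next σ (n, γ), D.name (D.next σ (n, γ))) :=
  (D.exists_perm σ).choose_spec (n, γ)

/-- The public 1qfa verifier running a deterministic protocol. -/
def verifier : Verifier α where
  Q := D.State
  Γ := Option D.N
  status
    | Sum.inl _ => Status.non
    | Sum.inr (true, _) => Status.acc
    | Sum.inr (false, _) => Status.rej
  start := Sum.inl D.start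
  start_non := rfl
  blank := none
  V σ := permUnitary (D.perm σ)

theorem eq_of_verifier_V_ne_zero {σ : TapeSymbol α} {n : D.N} {γ : Option D.N}
    {q' : D.verifier.Q} {ξ : D.verifier.Γ}
    (h : (D.verifier.V σ).1 (q', ξ) ((Sum.inl n, γ) : D.State × Option D.N) ≠ 0) :
    q' = D.next σ (n, γ) ∧ ξ = D.name q' := by
  have h' := (permUnitary_ne_zero_iff (D.perm σ) _ _).1 h
  have h'' := (D.perm_apply σ n γ).symm.trans h'
  cases h''
  exact ⟨rfl, rfl⟩

theorem verifier_isPublic : D.verifier.IsPublic := by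
  refine ⟨D.name, ?_, ?_, ?_⟩
  · rintro (n | ⟨_ | _, _⟩) hn (m | ⟨_ | _, _⟩) hm h <;> first | cases hn; done | cases hm; done | skip
    exact congrArg Sum.inl (Option.some.inj h)
  · rintro (n | ⟨_ | _, _⟩) hn h
    · cases h
    · cases hn
    · cases hn
  · rintro σ (n | ⟨_ | _, _⟩) γ hn q' ξ h
    · exact (D.eq_of_verifier_V_ne_zero h).2
    · cases hn
    · cases hn

/-- Invariants of a deterministic protocol decide its outcome. Here `I t n γ` is a property of the
inner state `n` and of the communication symbol `γ` before the verifier's step `t + 1`. -/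
theorem protocolProb_verifier_eq_one {P : Prover α D.verifier.Γ} {x : List α} (outcome : Bool)
    (I : ℕ → D.N → Option D.N → Prop) (h0 : I 0 D.start none)
    (hstep : ∀ t n γ n' (ξ' : D.verifier.Γ) w w', I t n γ →
      D.δ (tapeCell x t) (n, γ) = Sum.inl n' →
      (P.strategy x t).1 (ξ', w) (some n', w') ≠ 0 → I (t + 1) n' ξ')
    (houtcome : ∀ t, t < x.length + 2 → ∀ n γ b, I t n γ →
      D.δ (tapeCell x t) (n, γ) = Sum.inr b → b = outcome)
    (hend : ∀ n γ, ¬ I (x.length + 2) n γ) :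
    protocolProb D.verifier P (if outcome then Status.acc else Status.rej) x = 1 := by
  refine protocolProb_eq_one (bad := if outcome then Status.rej else Status.acc)
    (fun t q γ => ∃ n, q = Sum.inl n ∧ I t n γ) ?_ ⟨D.start, rfl, h0⟩ ?_ ?_ ?_
  · cases outcome <;> simp
  · rintro t q γ q' ξ ξ' w w' ⟨n, rfl, hI⟩ hV hs hP
    obtain ⟨h1, rfl⟩ := D.eq_of_verifier_V_ne_zero hV
    unfold next at h1
    split at h1
    · rename_i n' hn'
      subst h1
      exact ⟨n', rfl, hstep t n γ n' ξ' w w' hI hn' hP⟩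
    · rename_i b _
      subst h1
      cases b <;> cases hs
  · rintro t ht q γ q' ξ ⟨n, rfl, hI⟩ hV hs
    obtain ⟨h1, rfl⟩ := D.eq_of_verifier_V_ne_zero hV
    unfold next at h1
    split at h1
    · subst h1
      cases outcome <;> cases hs
    · rename_i b hb
      subst h1
      have := houtcome t ht n γ b hI hb
      subst this
      cases b <;> cases hs
  · rintro q γ ⟨n, -, hI⟩
    exact hend n γ hI

end DetProtocol

/-! ### A public protocol for `Zero`. -/

theorem tapeCell_succ_of_getElem? {α : Type} {x : List α} {i : ℕ} {a : α} (h : x[i]? = some a) :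
    tapeCell x (i + 1) = TapeSymbol.letter a := by
  simp [tapeCell, h]

theorem tapeCell_length_succ {α : Type} (x : List α) :
    tapeCell x (x.length + 1) = TapeSymbol.rightEnd := by
  simp [tapeCell]

theorem tapeCell_letter_of_lt {α : Type} {x : List α} {i : ℕ} (h : i < x.length) :
    ∃ a, tapeCell x (i + 1) = TapeSymbol.letter a :=
  ⟨x[i], tapeCell_succ_of_getElem? (List.getElem?_eq_getElem h)⟩

theorem mem_zero_of_tapeCell {x : List (Fin 2)}
    (h : tapeCell x x.length = TapeSymbol.letter 0) : x ∈ zeroLanguage.words := by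
  rcases List.eq_nil_or_concat x with rfl | ⟨w, a, rfl⟩
  · cases h
  · simp only [List.concat_eq_append, List.length_append, List.length_singleton, tapeCell] at h
    simp at h
    exact ⟨w, by simp [h]⟩

/-- The verifier for `zeroLanguage`: it stays in state `false` as long as the prover tells it to
(by the symbol `some false`), and moves to state `true` when the prover claims (by the symbol
`some true`) that the scanned letter is the last one and this letter is `0`. -/
def zeroStep : TapeSymbol (Fin 2) → Bool × Option Bool → Bool ⊕ Bool
  | TapeSymbol.leftEnd, (false, none) => Sum.inl false
  | TapeSymbol.letter _, (false, some false) => Sum.inl false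
  | TapeSymbol.letter a, (false, some true) => if a = 0 then Sum.inl true else Sum.inr false
  | TapeSymbol.rightEnd, (true, _) => Sum.inr true
  | _, _ => Sum.inr false

/-- In each case `σ` and `n'` determine `n` and `γ`, which is the injectivity needed for
reversibility. -/
theorem zeroStep_eq_inl {σ : TapeSymbol (Fin 2)} {n n' : Bool} {γ : Option Bool}
    (h : zeroStep σ (n, γ) = Sum.inl n') :
    n = false ∧ ((σ = TapeSymbol.leftEnd ∧ γ = none ∧ n' = false) ∨
      (∃ a, σ = TapeSymbol.letter a ∧ γ = some false ∧ n' = false) ∨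
      (σ = TapeSymbol.letter 0 ∧ γ = some true ∧ n' = true)) := by
  rcases σ with _ | a | _ <;> rcases n with _ | _ <;> rcases γ with _ | _ | _ <;>
    simp_all [zeroStep]
  split_ifs at h
  simp_all

theorem zeroStep_eq_inr_true {σ : TapeSymbol (Fin 2)} {n : Bool} {γ : Option Bool}
    (h : zeroStep σ (n, γ) = Sum.inr true) : σ = TapeSymbol.rightEnd ∧ n = true := by
  rcases σ with _ | a | _ <;> rcases n with _ | _ <;> rcases γ with _ | _ | _ <;>
    simp_all [zeroStep]
  split_ifs at h
  simp_all

/-- The protocol for `zeroLanguage`. -/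
def zeroProtocol : DetProtocol (Fin 2) where
  N := Bool
  start := false
  δ := zeroStep
  δ_inj := by
    rintro σ ⟨n, γ⟩ ⟨m, γ'⟩ k h h'
    obtain ⟨rfl, h1⟩ := zeroStep_eq_inl h
    obtain ⟨rfl, h2⟩ := zeroStep_eq_inl h'
    grind

/-- The prover announcing the last letter. -/
def zeroProver : Prover (Fin 2) zeroProtocol.verifier.Γ where
  Δ := Unit
  blank := ()
  width _ _ := 0
  strategy x i :=
    -- Turn `i` precedes the scan of cell `i + 1`, which holds the last letter exactly when `i + 1 =
    -- x.length`; negation then turns `some false` into `some true`.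
    permUnitary (if i + 1 = x.length then
      Equiv.prodCongr (Equiv.optionCongr Equiv.boolNot) (Equiv.refl _) else Equiv.refl _)

theorem zeroProver_reply {x : List (Fin 2)} {i : ℕ} {n : Bool} {ξ : Option Bool}
    {y y' : Fin 0 → Unit} (h : (zeroProver.strategy x i).1 (ξ, y) (some n, y') ≠ 0) :
    ξ = some (if i + 1 = x.length then !n else n) := by
  have h' := congrArg Prod.fst ((permUnitary_ne_zero_iff _ _ _).1 h)
  split_ifs at h' ⊢ <;> exact h'.symm

/-- The situation before step `t + 1` on an input with `l + 1` letters, the last one being `0`. -/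
def ZeroInvariant (l t : ℕ) (n : Bool) (γ : Option Bool) : Prop :=
  (t = 0 ∧ n = false ∧ γ = none) ∨ (0 < t ∧ t < l + 1 ∧ n = false ∧ γ = some false) ∨
    (t = l + 1 ∧ n = false ∧ γ = some true) ∨ (t = l + 2 ∧ n = true)

theorem ZeroInvariant.succ {l t : ℕ} {n n' : Bool} {γ : Option Bool} {σ : TapeSymbol (Fin 2)}
    (hI : ZeroInvariant l t n γ) (hδ : zeroStep σ (n, γ) = Sum.inl n') :
    ZeroInvariant l (t + 1) n' (some (if t = l then !n' else n')) := by
  unfold ZeroInvariant at *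
  obtain ⟨rfl, hcase⟩ := zeroStep_eq_inl hδ
  rcases hI with ⟨rfl, -, rfl⟩ | ⟨ht, ht', -, rfl⟩ | ⟨rfl, -, rfl⟩ | ⟨-, h⟩
  · obtain rfl : n' = false := by
      simp at hcase
      exact hcase.2
    split_ifs with h
    · simp [← h]
    · simp; omega
  · obtain rfl : n' = false := by
      simp at hcase
      exact hcase.2
    split_ifs with h
    · simp [h]
    · simp; omega
  · obtain rfl : n' = true := by
      simp at hcase
      exact hcase.2
    simp
  · cases h

theorem zeroProver_complete {x : List (Fin 2)} (hx : x ∈ zeroLanguage.words) :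
    protocolProb zeroProtocol.verifier zeroProver Status.acc x = 1 := by
  obtain ⟨w, rfl⟩ := hx
  have hlast : tapeCell (w ++ [0]) (w.length + 1) = TapeSymbol.letter (0 : Fin 2) :=
    tapeCell_succ_of_getElem? (by simp)
  have hright : tapeCell (w ++ [(0 : Fin 2)]) (w.length + 2) = TapeSymbol.rightEnd := by
    simpa using tapeCell_length_succ (w ++ [(0 : Fin 2)])
  refine zeroProtocol.protocolProb_verifier_eq_one true (ZeroInvariant w.length) ?_ ?_ ?_ ?_
  · exact Or.inl ⟨rfl, rfl, rfl⟩
  · intro t n γ n' ξ' y y' hI hδ hP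
    have hξ := zeroProver_reply hP
    simp only [List.length_append, List.length_singleton, Nat.add_right_cancel_iff] at hξ
    rw [hξ]
    exact hI.succ hδ
  · rintro t - n γ (_ | _) hI hδ
    · change zeroStep _ _ = _ at hδ
      rcases hI with ⟨rfl, rfl, rfl⟩ | ⟨ht, ht', rfl, rfl⟩ | ⟨rfl, rfl, rfl⟩ | ⟨rfl, rfl⟩
      · cases hδ
      · obtain ⟨i, rfl⟩ := Nat.exists_eq_add_of_lt ht
        obtain ⟨a, ha⟩ := tapeCell_letter_of_lt (x := w ++ [(0 : Fin 2)]) (i := i)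
          (by simp; omega)
        rw [zero_add, ha] at hδ
        cases hδ
      · rw [hlast] at hδ
        cases hδ
      · rw [hright] at hδ
        cases hδ
    · rfl
  · intro n γ hI
    unfold ZeroInvariant at hI
    simp only [List.length_append, List.length_singleton] at hI
    omega

theorem zeroProtocol_sound {x : List (Fin 2)} (hx : x ∉ zeroLanguage.words)
    (P : Prover (Fin 2) zeroProtocol.verifier.Γ) :
    protocolProb zeroProtocol.verifier P Status.rej x = 1 := by
  -- The received symbol is unconstrained, so the prover is arbitrary. State `true` certifies that
  -- the previous cell held 0; the truncated `t - 1` at `t = 0` is harmless because the state is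
  -- then `false`.
  refine zeroProtocol.protocolProb_verifier_eq_one false (fun t (n : Bool) (_ : Option Bool) =>
    t ≤ x.length + 1 ∧ (n = true → tapeCell x (t - 1) = TapeSymbol.letter 0)) ?_ ?_ ?_ ?_
  · exact ⟨by omega, fun h => by cases h⟩
  · rintro t n γ n' ξ' y y' ⟨ht, -⟩ hδ -
    obtain ⟨-, hcase⟩ := zeroStep_eq_inl hδ
    have hne : t ≠ x.length + 1 := by
      rintro rfl
      rw [tapeCell_length_succ] at hcase
      rcases hcase with ⟨h, -⟩ | ⟨a, h, -⟩ | ⟨h, -⟩ <;> cases h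
    refine ⟨by omega, fun h => ?_⟩
    rcases hcase with ⟨-, -, h'⟩ | ⟨a, -, -, h'⟩ | ⟨h', -⟩
    · exact absurd (h.symm.trans h') (by decide)
    · exact absurd (h.symm.trans h') (by decide)
    · exact h'
  · rintro t - n γ (_ | _) ⟨ht, hn⟩ hδ
    · rfl
    · obtain ⟨h1, h2⟩ := zeroStep_eq_inr_true hδ
      have h3 := hn h2
      have h4 : t = x.length + 1 := by
        by_contra hne
        rcases Nat.eq_zero_or_pos t with rfl | hpos
        · cases h1
        · obtain ⟨i, rfl⟩ := Nat.exists_eq_add_of_lt hpos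
          obtain ⟨a, ha⟩ := tapeCell_letter_of_lt (x := x) (i := i) (by omega)
          rw [zero_add, ha] at h1
          cases h1
      subst h4
      exact absurd (mem_zero_of_tapeCell h3) hx
  · rintro n γ ⟨h, -⟩
    omega

theorem zero_mem_publicQIP : zeroLanguage ∈ PublicQIP 1 1 :=
  ⟨zeroProtocol.verifier, zeroProver, zeroProtocol.verifier_isPublic,
    fun _ hx => (zeroProver_complete hx).ge, fun _ hx P => (zeroProtocol_sound hx P).ge⟩

/-! ### Reversible automata -/

namespace OneWayQFA

variable {α : Type} {M : OneWayQFA α}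

/-- Column `q` has squared norm 1; with 0/1 entries this norm counts the ones. -/
theorem IsReversible.existsUnique_row (h : M.IsReversible) (σ : TapeSymbol α) (q : M.Q) :
    ∃! q', (M.V σ : Matrix M.Q M.Q ℂ) q' q = 1 := by
  have h1 := congrFun (congrFun (Matrix.UnitaryGroup.star_mul_self (M.V σ)) q) q
  rw [Matrix.one_apply_eq, Matrix.mul_apply] at h1
  have h2 : ∀ q', star (M.V σ : Matrix M.Q M.Q ℂ) q q' * (M.V σ : Matrix M.Q M.Q ℂ) q' q =
      if (M.V σ : Matrix M.Q M.Q ℂ) q' q = 1 then 1 else 0 := by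
    intro q'
    rw [Matrix.star_apply]
    rcases h σ q' q with h | h <;> simp [h]
  simp only [h2, Finset.sum_boole] at h1
  have h3 := Finset.card_eq_one.1 (Nat.cast_eq_one.1 h1)
  obtain ⟨a, ha⟩ := h3
  refine ⟨a, ?_, fun b hb => ?_⟩
  · have : a ∈ ({a} : Finset M.Q) := Finset.mem_singleton_self a
    rw [← ha] at this
    simpa using this
  · have : b ∈ ({a} : Finset M.Q) := by rw [← ha]; simpa using hb
    simpa using this

/-- Distinct columns sharing a one would have inner product 1 instead of 0. -/
theorem IsReversible.eq_of_col (h : M.IsReversible) {σ : TapeSymbol α} {q p r : M.Q}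
    (hq : (M.V σ : Matrix M.Q M.Q ℂ) r q = 1) (hp : (M.V σ : Matrix M.Q M.Q ℂ) r p = 1) :
    q = p := by
  by_contra hne
  have h1 := congrFun (congrFun (Matrix.UnitaryGroup.star_mul_self (M.V σ)) q) p
  rw [Matrix.one_apply_ne hne, Matrix.mul_apply, Finset.sum_eq_single r] at h1
  · simp [Matrix.star_apply, hq, hp] at h1
  · intro s _ hs
    rcases h σ s q with h0 | h0
    · simp [Matrix.star_apply, h0]
    · exact absurd ((h.existsUnique_row σ q).unique h0 hq) hs
  · simp

/-- The transition function of a reversible automaton. -/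
def IsReversible.next (h : M.IsReversible) (σ : TapeSymbol α) (q : M.Q) : M.Q :=
  (h.existsUnique_row σ q).choose

theorem IsReversible.next_injective (h : M.IsReversible) (σ : TapeSymbol α) :
    Function.Injective (h.next σ) := fun q p hqp =>
  h.eq_of_col (h.existsUnique_row σ q).choose_spec.1
    (by
      have := (h.existsUnique_row σ p).choose_spec.1
      change (M.V σ : Matrix M.Q M.Q ℂ) (h.next σ p) p = 1 at this
      rw [← hqp] at this
      exact this)

theorem IsReversible.move_single (h : M.IsReversible) (σ : TapeSymbol α) (q : M.Q) :
    M.move σ (Pi.single q 1) = Pi.single (h.next σ q) 1 := by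
  funext r
  rw [move, Matrix.mulVec_single_one]
  change (M.V σ : Matrix M.Q M.Q ℂ) r q = _
  by_cases hr : r = h.next σ q
  · rw [hr, Pi.single_eq_same]
    exact (h.existsUnique_row σ q).choose_spec.1
  · rw [Pi.single_eq_of_ne hr]
    refine (h σ r q).resolve_right fun h1 => hr ?_
    exact (h.existsUnique_row σ q).choose_spec.2 r h1

theorem IsReversible.state_succ_of_single (h : M.IsReversible) {x : List α} {t : ℕ} {q : M.Q}
    (hq : M.state x t = Pi.single q 1) :
    M.state x (t + 1) = if M.status (h.next (tapeCell x t) q) = Status.non then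
      Pi.single (h.next (tapeCell x t) q) 1 else 0 := by
  funext r
  rw [state, hq, h.move_single]
  by_cases hr : r = h.next (tapeCell x t) q
  · subst hr
    split_ifs with hs <;> simp [hs]
  · split_ifs <;> simp [hr]

theorem state_succ_of_zero {x : List α} {t : ℕ} (h0 : M.state x t = 0) :
    M.state x (t + 1) = 0 := by
  funext r
  simp [state, h0, move]

theorem IsReversible.state_eq (h : M.IsReversible) (x : List α) (t : ℕ) :
    M.state x t = 0 ∨ ∃ q, M.status q = Status.non ∧ M.state x t = Pi.single q 1 := by
  induction t with
  | zero => exact Or.inr ⟨M.start, M.start_non, rfl⟩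
  | succ t ih =>
    rcases ih with h0 | ⟨q, -, hq⟩
    · exact Or.inl (state_succ_of_zero h0)
    · rw [h.state_succ_of_single hq]
      split_ifs with hs
      · exact Or.inr ⟨_, hs, rfl⟩
      · exact Or.inl rfl

theorem state_eq_zero_of_le {x : List α} {s t : ℕ} (h0 : M.state x s = 0) (hst : s ≤ t) :
    M.state x t = 0 := by
  induction t, hst using Nat.le_induction with
  | base => exact h0
  | succ t _ ih => exact state_succ_of_zero ih

/-- A reversible automaton halting with status `good` with positive probability never halts with
another status and halts for sure. -/
theorem IsReversible.of_haltProb_pos (h : M.IsReversible) {x : List α} {good : Status}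
    (hgood : good ≠ Status.non) (hpos : 0 < M.haltProb good x) :
    M.state x (x.length + 2) = 0 ∧ ∀ t q, M.state x t = Pi.single q 1 →
      M.status (h.next (tapeCell x t) q) = Status.non ∨
      M.status (h.next (tapeCell x t) q) = good := by
  obtain ⟨t₀, ht₀, hne⟩ := Finset.exists_ne_zero_of_sum_ne_zero hpos.ne'
  obtain ⟨r, -, hr⟩ := Finset.exists_ne_zero_of_sum_ne_zero hne
  split_ifs at hr with hs
  rotate_left
  · exact absurd rfl hr
  rcases h.state_eq x t₀ with h0 | ⟨q₀, hq₀, hst⟩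
  · simp [h0, move] at hr
  rw [hst, h.move_single] at hr
  have hrq : r = h.next (tapeCell x t₀) q₀ := by
    by_contra hrq
    simp [hrq] at hr
  subst hrq
  have hzero : M.state x (t₀ + 1) = 0 := by
    rw [h.state_succ_of_single hst, if_neg (by rw [hs]; exact hgood)]
  refine ⟨state_eq_zero_of_le hzero (Finset.mem_range.1 ht₀), fun t q hq => ?_⟩
  -- Halting before `t₀` would make the state vanish at `t₀`, and after `t₀` it does vanish.
  rcases lt_trichotomy t t₀ with hlt | rfl | hlt
  · left
    by_contra hnon
    have h0 := h.state_succ_of_single hq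
    rw [if_neg hnon] at h0
    have h1 := state_eq_zero_of_le h0 hlt
    rw [hst] at h1
    simp at h1
  · right
    have : q = q₀ := by
      by_contra hqq
      have h1 := congrFun (hq.symm.trans hst) q
      simp [hqq] at h1
    rw [this, hs]
  · have h1 := state_eq_zero_of_le hzero hlt
    rw [hq] at h1
    simp at h1

variable (M) in
/-- The inner states in which the computation continues. -/
abbrev NonHalting : Type := {q : M.Q // M.status q = Status.non}

/-- The symbol that the prover has to return before `σ` is scanned in state `n`. -/
def expectedSymbol (σ : TapeSymbol α) (n : M.NonHalting) : Option M.NonHalting :=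
  match σ with
  | TapeSymbol.leftEnd => none
  | _ => some n

/-- The inner state `q` as the outcome of a step. -/
def outcomeOf (q : M.Q) : M.NonHalting ⊕ Bool :=
  if h : M.status q = Status.non then Sum.inl ⟨q, h⟩ else Sum.inr (decide (M.status q = Status.acc))

/-- The prover that never changes anything. -/
def idProver (α Γ : Type) [Fintype Γ] [DecidableEq Γ] : Prover α Γ where
  Δ := Unit
  blank := ()
  width _ _ := 0
  strategy _ _ := permUnitary (Equiv.refl _)

theorem eq_of_idProver_strategy_ne_zero {Γ : Type} [Fintype Γ] [DecidableEq Γ] {x : List α} {i : ℕ}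
    {ξ ξ' : Γ} {y y' : Fin 0 → Unit} (h : ((idProver α Γ).strategy x i).1 (ξ', y) (ξ, y') ≠ 0) :
    ξ' = ξ :=
  (congrArg Prod.fst ((permUnitary_ne_zero_iff _ _ _).1 h)).symm

theorem outcomeOf_eq_inl {q : M.Q} {n : M.NonHalting} (h : outcomeOf q = Sum.inl n) :
    M.status q = Status.non ∧ q = n.1 := by
  unfold outcomeOf at h
  split_ifs at h with h'
  exact ⟨h', congrArg Subtype.val (Sum.inl.inj h)⟩

theorem outcomeOf_eq_inr {q : M.Q} {b : Bool} (h : outcomeOf q = Sum.inr b) :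
    M.status q ≠ Status.non ∧ b = decide (M.status q = Status.acc) := by
  unfold outcomeOf at h
  split_ifs at h with h'
  exact ⟨h', (Sum.inr.inj h).symm⟩

/-- The simulation of a step of a reversible automaton, rejecting as soon as the prover does not
return the announcement received. -/
def IsReversible.step (h : M.IsReversible) (σ : TapeSymbol α)
    (a : M.NonHalting × Option M.NonHalting) : M.NonHalting ⊕ Bool :=
  if a.2 = expectedSymbol σ a.1 then outcomeOf (h.next σ a.1.1) else Sum.inr false

theorem IsReversible.step_eq_inl (h : M.IsReversible) {σ : TapeSymbol α}
    {n n' : M.NonHalting} {γ : Option M.NonHalting} (hδ : h.step σ (n, γ) = Sum.inl n') :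
    γ = expectedSymbol σ n ∧ h.next σ n.1 = n'.1 := by
  unfold step at hδ
  split_ifs at hδ with hγ
  exact ⟨hγ, (outcomeOf_eq_inl hδ).2⟩

theorem IsReversible.step_eq_inr (h : M.IsReversible) {σ : TapeSymbol α}
    {n : M.NonHalting} {γ : Option M.NonHalting} {b : Bool} (hδ : h.step σ (n, γ) = Sum.inr b) :
    (M.status (h.next σ n.1) ≠ Status.non ∧ b = decide (M.status (h.next σ n.1) = Status.acc)) ∨
      (γ ≠ expectedSymbol σ n ∧ b = false) := by
  unfold step at hδ
  split_ifs at hδ with hγ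
  · exact Or.inl (outcomeOf_eq_inr hδ)
  · exact Or.inr ⟨hγ, (Sum.inr.inj hδ).symm⟩

/-- The protocol simulating a reversible automaton. -/
def IsReversible.protocol (h : M.IsReversible) : DetProtocol α where
  N := M.NonHalting
  start := ⟨M.start, M.start_non⟩
  δ := h.step
  δ_inj := by
    rintro σ ⟨n, γ⟩ ⟨m, γ'⟩ k h1 h2
    -- On continuing transitions the check makes `γ` a function of `σ` and the state, so injectivity
    -- reduces to that of `next`.
    obtain ⟨rfl, h3⟩ := h.step_eq_inl h1
    obtain ⟨rfl, h4⟩ := h.step_eq_inl h2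
    obtain rfl : n = m := Subtype.ext (h.next_injective σ (h3.trans h4.symm))
    rfl

theorem expectedSymbol_tapeCell (x : List α) (t : ℕ) (n : M.NonHalting) :
    expectedSymbol (tapeCell x t) n = if t = 0 then none else some n := by
  rcases t with _ | t
  · rfl
  · rw [if_neg t.succ_ne_zero, tapeCell]
    split <;> rfl

theorem IsReversible.state_succ_eq_single (h : M.IsReversible) {x : List α} {t : ℕ}
    {n n' : M.NonHalting} (hn : M.state x t = Pi.single n.1 1)
    (hnext : h.next (tapeCell x t) n.1 = n'.1) : M.state x (t + 1) = Pi.single n'.1 1 := by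
  rw [h.state_succ_of_single hn, hnext, if_pos n'.2]

theorem IsReversible.protocolProb_acc_eq_one (h : M.IsReversible) {x : List α}
    (hpos : 0 < M.haltProb Status.acc x) :
    protocolProb h.protocol.verifier (idProver α h.protocol.verifier.Γ) Status.acc x = 1 := by
  obtain ⟨hend, hhalt⟩ := h.of_haltProb_pos (by decide) hpos
  refine h.protocol.protocolProb_verifier_eq_one true (fun t n γ =>
    M.state x t = Pi.single n.1 1 ∧ γ = if t = 0 then none else some n) ⟨rfl, rfl⟩ ?_ ?_ ?_
  · rintro t n γ n' ξ' y y' ⟨hst, hγ⟩ hδ hP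
    refine ⟨h.state_succ_eq_single hst (h.step_eq_inl hδ).2, ?_⟩
    rw [if_neg (Nat.succ_ne_zero t)]
    exact eq_of_idProver_strategy_ne_zero hP
  · rintro t ht n γ b ⟨hst, hγ⟩ hδ
    rcases h.step_eq_inr hδ with ⟨h1, rfl⟩ | ⟨h1, -⟩
    · exact decide_eq_true ((hhalt t n.1 hst).resolve_left h1)
    · exact absurd (hγ.trans (expectedSymbol_tapeCell x t n).symm) h1
  · rintro n γ ⟨hst, -⟩
    rw [hend] at hst
    simpa using congrFun hst n.1

/-- The invariant ignores the prover's reply: an altered announcement only leads to rejection, the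
outcome claimed. -/
theorem IsReversible.protocolProb_rej_eq_one (h : M.IsReversible) {x : List α}
    (hpos : 0 < M.haltProb Status.rej x) (P : Prover α h.protocol.verifier.Γ) :
    protocolProb h.protocol.verifier P Status.rej x = 1 := by
  obtain ⟨hend, hhalt⟩ := h.of_haltProb_pos (by decide) hpos
  refine h.protocol.protocolProb_verifier_eq_one false (fun t n _ =>
    M.state x t = Pi.single n.1 1) rfl ?_ ?_ ?_
  · intro t n γ n' ξ' y y' hst hδ _
    exact h.state_succ_eq_single hst (h.step_eq_inl hδ).2
  · intro t ht n γ b hst hδ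
    rcases h.step_eq_inr hδ with ⟨h1, rfl⟩ | ⟨-, h1⟩
    · rw [(hhalt t n.1 hst).resolve_left h1]
      rfl
    · exact h1
  · intro n γ hst
    rw [hend] at hst
    simpa using congrFun hst n.1

end OneWayQFA

/-- Only positivity of `1 / 2 + ε` matters, since the run is deterministic. -/
theorem oneRFA_subset_publicQIP : OneRFA ⊆ PublicQIP 1 1 := by
  rintro L ⟨M, hM, ε, hε, hacc, hrej⟩
  exact ⟨hM.protocol.verifier, OneWayQFA.idProver _ _, hM.protocol.verifier_isPublic,
    fun x hx => (hM.protocolProb_acc_eq_one (by linarith [hacc x hx])).ge,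
    fun x hx P => (hM.protocolProb_rej_eq_one (by linarith [hrej x hx]) P).ge⟩

/-! ### Recurrence of the powers of a unitary matrix. -/

open scoped Matrix.Norms.L2Operator in
/-- The powers of a unitary matrix come back arbitrarily close to the identity. -/
theorem exists_unitary_pow_near_one {Q : Type} [Fintype Q] [DecidableEq Q] [Nonempty Q]
    (U : Matrix.unitaryGroup Q ℂ) {η : ℝ} (hη : 0 < η) :
    ∃ j : ℕ, 0 < j ∧ ‖((U ^ j : Matrix.unitaryGroup Q ℂ) : Matrix Q Q ℂ) - 1‖ < η := by
  have : ProperSpace (Matrix Q Q ℂ) := FiniteDimensional.proper ℂ _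
  have hc : IsCompact (Matrix.unitaryGroup Q ℂ : Set (Matrix Q Q ℂ)) := by
    refine Metric.isCompact_of_isClosed_isBounded isClosed_unitary ?_
    refine (Metric.isBounded_closedBall (x := (0 : Matrix Q Q ℂ)) (r := 1)).subset fun V hV => ?_
    rw [mem_closedBall_zero_iff]
    exact (CStarRing.norm_of_mem_unitary hV).le
  have : CompactSpace (Matrix.unitaryGroup Q ℂ) := isCompact_iff_compactSpace.1 hc
  have hcont : Continuous fun V : Matrix.unitaryGroup Q ℂ => ‖(V : Matrix Q Q ℂ) - 1‖ :=
    (continuous_subtype_val.sub continuous_const).norm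
  have hev : ∀ᶠ V : Matrix.unitaryGroup Q ℂ in nhds 1, ‖(V : Matrix Q Q ℂ) - 1‖ < η :=
    hcont.continuousAt.eventually_lt continuousAt_const (by simpa using hη)
  -- In a compact group the identity is a cluster point of the powers of any element, so arbitrarily
  -- large exponents work.
  obtain ⟨j, h1, h2⟩ :=
    (((mapClusterPt_one_atTop_pow U).frequently hev).and_eventually
      (Filter.eventually_gt_atTop 0)).exists
  exact ⟨j, h2, h1⟩

/-! ### The Euclidean norm of amplitude vectors. -/

section EuclideanNorm

variable {Q : Type} [Fintype Q]

/-- The Euclidean norm of a vector of amplitudes. -/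
def ampNorm (v : Q → ℂ) : ℝ := ‖WithLp.toLp 2 v‖

theorem ampNorm_sq (v : Q → ℂ) : ampNorm v ^ 2 = ∑ q, ‖v q‖ ^ 2 :=
  EuclideanSpace.norm_sq_eq _

theorem ampNorm_nonneg (v : Q → ℂ) : 0 ≤ ampNorm v := norm_nonneg _

theorem ampNorm_add_le (v w : Q → ℂ) : ampNorm (v + w) ≤ ampNorm v + ampNorm w :=
  norm_add_le (WithLp.toLp 2 v) (WithLp.toLp 2 w)

theorem ampNorm_sub_comm (v w : Q → ℂ) : ampNorm (v - w) = ampNorm (w - v) :=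
  norm_sub_rev (WithLp.toLp 2 v) (WithLp.toLp 2 w)

theorem abs_ampNorm_sub_le (v w : Q → ℂ) : |ampNorm v - ampNorm w| ≤ ampNorm (v - w) :=
  abs_norm_sub_norm_le (WithLp.toLp 2 v) (WithLp.toLp 2 w)

variable [DecidableEq Q]

theorem ampNorm_unitary_mulVec (U : Matrix.unitaryGroup Q ℂ) (v : Q → ℂ) :
    ampNorm ((U : Matrix Q Q ℂ).mulVec v) = ampNorm v := by
  have key : ∀ w : Q → ℂ, ((ampNorm w ^ 2 : ℝ) : ℂ) = dotProduct (star w) w := by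
    intro w
    rw [ampNorm_sq, dotProduct, Complex.ofReal_sum]
    refine Finset.sum_congr rfl fun q _ => ?_
    rw [Pi.star_apply, Complex.star_def, ← Complex.normSq_eq_conj_mul_self,
      Complex.normSq_eq_norm_sq]
  have h : ampNorm ((U : Matrix Q Q ℂ).mulVec v) ^ 2 = ampNorm v ^ 2 := by
    have : ((ampNorm ((U : Matrix Q Q ℂ).mulVec v) ^ 2 : ℝ) : ℂ) = (ampNorm v ^ 2 : ℝ) := by
      rw [key, key, Matrix.star_mulVec, Matrix.dotProduct_mulVec, Matrix.vecMul_vecMul,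
        ← Matrix.star_eq_conjTranspose, Matrix.UnitaryGroup.star_mul_self, Matrix.vecMul_one]
    exact_mod_cast this
  exact (sq_eq_sq₀ (ampNorm_nonneg _) (ampNorm_nonneg _)).1 h

-- The operator norm makes one `j` serve all vectors, so `j` can be fixed before the word is chosen.
open scoped Matrix.Norms.L2Operator in
theorem exists_unitary_pow_mulVec_near [Nonempty Q] (U : Matrix.unitaryGroup Q ℂ) {η : ℝ}
    (hη : 0 < η) : ∃ j : ℕ, 0 < j ∧ ∀ v : Q → ℂ,
      ampNorm (((U ^ j : Matrix.unitaryGroup Q ℂ) : Matrix Q Q ℂ).mulVec v - v) ≤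
        η * ampNorm v := by
  obtain ⟨j, hj, hU⟩ := exists_unitary_pow_near_one U hη
  refine ⟨j, hj, fun v => ?_⟩
  have h := Matrix.l2_opNorm_mulVec
    (((U ^ j : Matrix.unitaryGroup Q ℂ) : Matrix Q Q ℂ) - 1) (WithLp.toLp 2 v)
  rw [Matrix.sub_mulVec, Matrix.one_mulVec] at h
  exact h.trans (mul_le_mul_of_nonneg_right hU.le (norm_nonneg _))

end EuclideanNorm

/-! ### Norm and halting probability of a measure-many automaton. -/

namespace OneWayQFA

variable {α : Type} (M : OneWayQFA α)

/-- The part of `v` supported on the inner states of status `s`. -/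
def cut (s : Status) (v : M.Q → ℂ) : M.Q → ℂ := fun q => if M.status q = s then v q else 0

theorem cut_sub (s : Status) (v w : M.Q → ℂ) : M.cut s v - M.cut s w = M.cut s (v - w) := by
  funext q
  simp only [cut, Pi.sub_apply]
  split_ifs <;> simp

theorem ampNorm_cut_sq (s : Status) (v : M.Q → ℂ) :
    ampNorm (M.cut s v) ^ 2 = ∑ q, if M.status q = s then ‖v q‖ ^ 2 else 0 := by
  rw [ampNorm_sq]
  refine Finset.sum_congr rfl fun q _ => ?_
  unfold cut
  split_ifs <;> simp

theorem ampNorm_sq_eq_sum_cut (v : M.Q → ℂ) :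
    ampNorm v ^ 2 = ampNorm (M.cut Status.non v) ^ 2 +
      (ampNorm (M.cut Status.acc v) ^ 2 + ampNorm (M.cut Status.rej v) ^ 2) := by
  rw [ampNorm_cut_sq, ampNorm_cut_sq, ampNorm_cut_sq, ← Finset.sum_add_distrib,
    ← Finset.sum_add_distrib, ampNorm_sq]
  refine Finset.sum_congr rfl fun q _ => ?_
  cases M.status q <;> simp

theorem ampNorm_cut_le (s : Status) (v : M.Q → ℂ) : ampNorm (M.cut s v) ≤ ampNorm v := by
  refine abs_le_of_sq_le_sq' ?_ (ampNorm_nonneg _) |>.2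
  have := M.ampNorm_sq_eq_sum_cut v
  cases s <;> nlinarith [sq_nonneg (ampNorm (M.cut Status.non v)),
    sq_nonneg (ampNorm (M.cut Status.acc v)), sq_nonneg (ampNorm (M.cut Status.rej v))]

/-- Pythagoras: a measurement that removes little squared norm moves the state only a little. -/
theorem ampNorm_sub_cut_non_sq (v : M.Q → ℂ) :
    ampNorm (v - M.cut Status.non v) ^ 2 = ampNorm v ^ 2 - ampNorm (M.cut Status.non v) ^ 2 := by
  rw [ampNorm_cut_sq, ampNorm_sq, ampNorm_sq, ← Finset.sum_sub_distrib]
  refine Finset.sum_congr rfl fun q _ => ?_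
  rw [Pi.sub_apply, cut]
  split_ifs <;> simp

theorem ampNorm_move (σ : TapeSymbol α) (v : M.Q → ℂ) : ampNorm (M.move σ v) = ampNorm v :=
  ampNorm_unitary_mulVec _ _

theorem move_sub (σ : TapeSymbol α) (v w : M.Q → ℂ) :
    M.move σ (v - w) = M.move σ v - M.move σ w := Matrix.mulVec_sub _ _ _

theorem state_succ (x : List α) (t : ℕ) :
    M.state x (t + 1) = M.cut Status.non (M.move (tapeCell x t) (M.state x t)) := rfl

/-- The probability of halting with status `s` during the first `n` steps. -/
def haltSum (s : Status) (x : List α) (n : ℕ) : ℝ :=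
  ∑ t ∈ Finset.range n, ampNorm (M.cut s (M.move (tapeCell x t) (M.state x t))) ^ 2

theorem haltProb_eq_haltSum (s : Status) (x : List α) :
    M.haltProb s x = M.haltSum s x (x.length + 2) := by
  unfold haltProb haltSum
  simp only [ampNorm_cut_sq]

theorem haltSum_nonneg (s : Status) (x : List α) (n : ℕ) : 0 ≤ M.haltSum s x n :=
  Finset.sum_nonneg fun _ _ => sq_nonneg _

theorem haltSum_mono (s : Status) (x : List α) {m n : ℕ} (h : m ≤ n) :
    M.haltSum s x m ≤ M.haltSum s x n :=
  Finset.sum_le_sum_of_subset_of_nonneg (Finset.range_mono h) fun _ _ _ => sq_nonneg _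

theorem haltSum_acc_add_rej (x : List α) (n : ℕ) :
    M.haltSum Status.acc x n + M.haltSum Status.rej x n + ampNorm (M.state x n) ^ 2 = 1 := by
  induction n with
  | zero =>
    rw [ampNorm_sq]
    simp [haltSum, state, Pi.single_apply, apply_ite]
  | succ n ih =>
    have h := M.ampNorm_sq_eq_sum_cut (M.move (tapeCell x n) (M.state x n))
    rw [ampNorm_move] at h
    rw [state_succ, haltSum, haltSum, Finset.sum_range_succ, Finset.sum_range_succ]
    change M.haltSum Status.acc x n + _ + (M.haltSum Status.rej x n + _) + _ = 1
    linarith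

theorem ampNorm_state_le_one (x : List α) (n : ℕ) : ampNorm (M.state x n) ≤ 1 := by
  have h := M.haltSum_acc_add_rej x n
  have h1 := M.haltSum_nonneg Status.acc x n
  have h2 := M.haltSum_nonneg Status.rej x n
  exact (sq_le_one_iff₀ (ampNorm_nonneg _)).1 (by linarith)

end OneWayQFA

/-! ### No 1qfa recognizes `Zero`. -/

theorem tapeCell_append {α : Type} (w u : List α) {t : ℕ} (ht : t ≤ w.length) :
    tapeCell (w ++ u) t = tapeCell w t := by
  rcases t with _ | t
  · rfl
  · rw [tapeCell, tapeCell, List.getElem?_append_left ht]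

namespace OneWayQFA

variable {α : Type} (M : OneWayQFA α)

/-- The state after `t` steps depends only on cells below `t`, and the two tapes agree up to cell
`w.length`. -/
theorem state_append (w u : List α) {t : ℕ} (ht : t ≤ w.length + 1) :
    M.state (w ++ u) t = M.state w t := by
  induction t with
  | zero => rfl
  | succ t ih => rw [state_succ, state_succ, ih (by omega), tapeCell_append w u (by omega)]

theorem haltSum_append (s : Status) (w u : List α) {n : ℕ} (hn : n ≤ w.length + 1) :
    M.haltSum s (w ++ u) n = M.haltSum s w n := by
  refine Finset.sum_congr rfl fun t ht => ?_
  have := Finset.mem_range.1 ht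
  rw [state_append M w u (by omega), tapeCell_append w u (by omega)]

/-- The non-halting part of the state after reading the left endmarker and `w`. -/
def readState (w : List α) : M.Q → ℂ := M.state w (w.length + 1)

theorem readState_append_singleton (w : List α) (a : α) :
    M.readState (w ++ [a]) =
      M.cut Status.non (M.move (TapeSymbol.letter a) (M.readState w)) := by
  rw [readState, state_succ, List.length_append, List.length_singleton,
    state_append M w [a] le_rfl, tapeCell_succ_of_getElem? (a := a) (by simp)]
  rfl

theorem haltProb_eq_add (s : Status) (w : List α) :
    M.haltProb s w = M.haltSum s w (w.length + 1) +
      ampNorm (M.cut s (M.move TapeSymbol.rightEnd (M.readState w))) ^ 2 := by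
  rw [haltProb_eq_haltSum, haltSum, Finset.sum_range_succ, tapeCell_length_succ]
  rfl

theorem ampNorm_readState_append_le (w u : List α) :
    ampNorm (M.readState (w ++ u)) ≤ ampNorm (M.readState w) := by
  induction u using List.reverseRecOn with
  | nil => simp
  | append_singleton u a ih =>
    rw [← List.append_assoc, readState_append_singleton]
    exact ((M.ampNorm_cut_le _ _).trans (M.ampNorm_move _ _).le).trans ih

/-- If no word leads to a state of squared norm less than `c`, and `w` leads to one of squared norm
at most `c + r ^ 2`, then reading `k` letters `a` after `w` acts up to an error `k * r` as a
unitary operator. -/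
theorem ampNorm_readState_replicate_sub_le {c r : ℝ} (hr : 0 ≤ r)
    (hc : ∀ w, c ≤ ampNorm (M.readState w) ^ 2) (w : List α)
    (hw : ampNorm (M.readState w) ^ 2 ≤ c + r ^ 2) (a : α) (k : ℕ) :
    ampNorm (M.readState (w ++ List.replicate k a) -
      ((M.V (TapeSymbol.letter a) ^ k : Matrix.unitaryGroup M.Q ℂ) :
        Matrix M.Q M.Q ℂ).mulVec (M.readState w)) ≤ k * r := by
  induction k with
  | zero => simp [ampNorm]
  | succ k ih =>
    set v := M.readState (w ++ List.replicate k a) with hv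
    set z := ((M.V (TapeSymbol.letter a) ^ k : Matrix.unitaryGroup M.Q ℂ) :
      Matrix M.Q M.Q ℂ).mulVec (M.readState w) with hz
    have h1 : M.readState (w ++ List.replicate (k + 1) a) =
        M.cut Status.non (M.move (TapeSymbol.letter a) v) := by
      rw [List.replicate_succ', ← List.append_assoc, readState_append_singleton]
    have h2 : ((M.V (TapeSymbol.letter a) ^ (k + 1) : Matrix.unitaryGroup M.Q ℂ) :
        Matrix M.Q M.Q ℂ).mulVec (M.readState w) = M.move (TapeSymbol.letter a) z := by
      rw [pow_succ', hz, move, Matrix.mulVec_mulVec]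
      rfl
    -- The squared norm is at most `c + r ^ 2` before the measurement and at least `c` after it, so
    -- the loss is at most `r ^ 2`.
    have h3 : ampNorm (M.cut Status.non (M.move (TapeSymbol.letter a) v) -
        M.move (TapeSymbol.letter a) v) ≤ r := by
      refine (abs_le_of_sq_le_sq' ?_ hr).2
      rw [ampNorm_sub_comm, ampNorm_sub_cut_non_sq, ← h1, ampNorm_move]
      have h4 := hc (w ++ List.replicate (k + 1) a)
      have h5 : ampNorm v ^ 2 ≤ ampNorm (M.readState w) ^ 2 :=
        pow_le_pow_left₀ (ampNorm_nonneg _) (M.ampNorm_readState_append_le _ _) 2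
      linarith
    -- The new measurement error adds to the old error, which the unitary move leaves unamplified.
    rw [h1, h2, ← sub_add_sub_cancel _ (M.move (TapeSymbol.letter a) v), ← move_sub]
    refine (ampNorm_add_le _ _).trans ?_
    rw [ampNorm_move]
    push_cast
    linarith

/-- The probability of the outcome `s` at the right endmarker depends continuously on the state. -/
theorem ampNorm_cut_move_sq_sub_le (s : Status) (σ : TapeSymbol α) {v z : M.Q → ℂ}
    (hv : ampNorm v ≤ 1) (hz : ampNorm z ≤ 1) :
    ampNorm (M.cut s (M.move σ v)) ^ 2 - ampNorm (M.cut s (M.move σ z)) ^ 2 ≤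
      2 * ampNorm (v - z) := by
  have h1 : ∀ y, ampNorm y ≤ 1 → ampNorm (M.cut s (M.move σ y)) ≤ 1 := fun y hy =>
    ((M.ampNorm_cut_le _ _).trans (M.ampNorm_move _ _).le).trans hy
  have h2 : ampNorm (M.cut s (M.move σ v)) - ampNorm (M.cut s (M.move σ z)) ≤ ampNorm (v - z) := by
    refine (le_abs_self _).trans ((abs_ampNorm_sub_le _ _).trans ?_)
    rw [cut_sub, ← move_sub]
    exact (M.ampNorm_cut_le _ _).trans (M.ampNorm_move _ _).le
  -- Factor the difference of squares; the sum of the two norms is at most 2.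
  nlinarith [h1 v hv, h1 z hz, ampNorm_nonneg (M.cut s (M.move σ v)),
    ampNorm_nonneg (M.cut s (M.move σ z)), ampNorm_nonneg (v - z)]

/-- For all letters `a` and `b` there is a word `w` ending in `b` whose acceptance
probability hardly decreases when a suitable positive number of letters `a` is appended. -/
theorem exists_haltProb_append_replicate (s : Status) (a b : α) {ε : ℝ} (hε : 0 < ε) :
    ∃ (w : List α) (j : ℕ), 0 < j ∧
      M.haltProb s (w ++ [b]) - ε ≤ M.haltProb s (w ++ [b] ++ List.replicate j a) := by
  have : Nonempty M.Q := ⟨M.start⟩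
  obtain ⟨j, hj, hU⟩ := exists_unitary_pow_mulVec_near (M.V (TapeSymbol.letter a))
    (η := ε / 4) (by linarith)
  have hj' : (0 : ℝ) < j := Nat.cast_pos.2 hj
  -- The `j` measurement errors total `ε / 4`; recurrence costs another `ε / 4`, and the factor 2
  -- for squared norms turns the sum into `ε`.
  set r : ℝ := ε / (4 * j) with hr
  have hr0 : 0 < r := by positivity
  have hbdd : BddBelow (Set.range fun w => ampNorm (M.readState w) ^ 2) :=
    ⟨0, by rintro _ ⟨w, rfl⟩; exact sq_nonneg _⟩
  obtain ⟨w, hw⟩ := exists_lt_of_ciInf_lt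
    (lt_add_of_pos_right (⨅ w, ampNorm (M.readState w) ^ 2) (pow_pos hr0 2))
  refine ⟨w, j, hj, ?_⟩
  set y := w ++ [b] with hy
  have hyw : ampNorm (M.readState y) ^ 2 ≤ ampNorm (M.readState w) ^ 2 :=
    pow_le_pow_left₀ (ampNorm_nonneg _) (M.ampNorm_readState_append_le _ _) 2
  have h1 := M.ampNorm_readState_replicate_sub_le hr0.le (fun w => ciInf_le hbdd w) y
    (hyw.trans hw.le) a j
  have hle : ∀ u, ampNorm (M.readState u) ≤ 1 := fun u => M.ampNorm_state_le_one _ _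
  have h2 := hU (M.readState y)
  have h3 : ampNorm (M.readState y - M.readState (y ++ List.replicate j a)) ≤ ε / 2 := by
    rw [ampNorm_sub_comm, ← sub_add_sub_cancel _ (((M.V (TapeSymbol.letter a) ^ j :
      Matrix.unitaryGroup M.Q ℂ) : Matrix M.Q M.Q ℂ).mulVec (M.readState y))]
    refine (ampNorm_add_le _ _).trans ?_
    have h4 : (j : ℝ) * r = ε / 4 := by
      rw [hr]
      field_simp
    nlinarith [hle y]
  have h5 := M.ampNorm_cut_move_sq_sub_le s TapeSymbol.rightEnd (hle y)
    (hle (y ++ List.replicate j a))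
  -- Probability collected before the endmarker is not lost when the word is extended.
  have h6 : M.haltSum s y (y.length + 1) ≤ M.haltSum s (y ++ List.replicate j a)
      ((y ++ List.replicate j a).length + 1) := by
    rw [← M.haltSum_append s y (List.replicate j a) le_rfl]
    exact M.haltSum_mono _ _ (by simp)
  rw [haltProb_eq_add, haltProb_eq_add]
  linarith

theorem haltProb_acc_add_rej_le_one (x : List α) :
    M.haltProb Status.acc x + M.haltProb Status.rej x ≤ 1 := by
  rw [haltProb_eq_haltSum, haltProb_eq_haltSum, ← M.haltSum_acc_add_rej x (x.length + 2)]
  exact le_add_of_nonneg_right (sq_nonneg _)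

/-- A measure-many 1qfa cannot tell the words ending in `b` from those ending in `a`. -/
theorem not_recognizes_of_last_letter {L : Language α} (a b : α) (hb : ∀ w, w ++ [b] ∈ L)
    (ha : ∀ w, w ++ [a] ∉ L) : ¬ M.Recognizes L := by
  rintro ⟨ε, hε, hacc, hrej⟩
  obtain ⟨w, j, hj, h⟩ := M.exists_haltProb_append_replicate Status.acc a b hε
  -- Positivity of `j` makes the extended word end in `a`, so it lies outside `L`.
  obtain ⟨i, rfl⟩ := Nat.exists_eq_succ_of_ne_zero hj.ne'
  rw [List.replicate_succ', ← List.append_assoc] at h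
  linarith [hacc _ (hb w), hrej _ (ha (w ++ [b] ++ List.replicate i a)),
    M.haltProb_acc_add_rej_le_one (w ++ [b] ++ List.replicate i a ++ [a])]

end OneWayQFA

theorem zero_not_mem_oneQFA : zeroLanguage ∉ OneQFA := by
  rintro ⟨M, hM⟩
  refine OneWayQFA.not_recognizes_of_last_letter (α := Fin 2) M (L := zeroLanguage.words) 1 0
    (fun w => ⟨w, rfl⟩) ?_ hM
  rintro w ⟨u, hu⟩
  have h : [(1 : Fin 2)] = [0] := List.append_inj_right' hu rfl
  exact absurd h (by decide)

end QFA

end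

theorem mainTheorem4 :
    QFA.OneRFA ⊂ QFA.PublicQIP 1 1 ∧
    ¬ QFA.PublicQIP 1 1 ⊆ QFA.OneQFA ∧
    QFA.zeroLanguage ∈ QFA.PublicQIP 1 1 ∧
    QFA.zeroLanguage ∉ QFA.OneQFA := by
  refine ⟨⟨QFA.oneRFA_subset_publicQIP, fun h => ?_⟩,
    fun h => QFA.zero_not_mem_oneQFA (h QFA.zero_mem_publicQIP),
    QFA.zero_mem_publicQIP, QFA.zero_not_mem_oneQFA⟩
  -- A reversible automaton is in particular a 1qfa, so `Zero` also witnesses strictness.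
  obtain ⟨M, -, hM⟩ := h QFA.zero_mem_publicQIP
  exact QFA.zero_not_mem_oneQFA ⟨M, hM⟩
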